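/- **Boxed-bandit model.** There are $M\ge 1$ boxes and $K$ arms, and fixed sets $\mathcal A_m\subseteq[K]$ of arms accessible from box $m\in[M]$ (in particular $\mathcal A_m=[K]$ for all $m$ is allowed). A problem instance is $C=(\boldsymbol q,\boldsymbol\mu)$, where $\boldsymbol q=(q_{m,k})$ satisfies $q_{m,k}>0$ for $k\in\mathcal A_m$, $q_{m,k}=0$ for $k\notin\mathcal A_m$ and $\sum_{k}q_{m,k}=1$ for every $m$, and $\boldsymbol\mu\in\mathbb R^K$ has a unique best arm $a^\star(\boldsymbol\mu)=\arg\max_k\mu_k$. When the learner selects a box $B_t=m$ at time $t$, arm $A_t=k$ is pulled with probability $q_{m,k}$ and a reward $X_t$ with law $\mathcal N(\mu_k,1)$ is produced; the learner observes $(A_t,X_t)$. A policy $\pi$ maps each history $(B_1,A_1,X_1,\dots,B_t,A_t,X_t)$, possibly in a randomised way, either to the next box $B_{t+1}$ or to the decision to stop and declare an arm $\hat a$; $\tau_\pi$ is the number of box selections before stopping ($\infty$ if the learner never stops). For $\delta\in(0,1)$, $\Pi(\delta)$ is the set of policies that, under every instance $C=(\boldsymbol q,\boldsymbol\mu)$,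 stop and declare an arm $\hat a\ne a^\star(\boldsymbol\mu)$ with probability at most $\delta$. **Theorem.** Let $C_0=(\boldsymbol q_0,\boldsymbol\mu_0)$ be an instance, with entries $q^0_{m,k}$ and $\mu^0_k$, and let $\mathbb E$ be the expectation under $C_0$. Then $$\liminf_{\delta\downarrow0}\ \inf_{\pi\in\Pi(\delta)}\frac{\mathbb E[\tau_\pi]}{\log(1/\delta)}\ \ge\ \frac1{T^*(\boldsymbol q_0,\boldsymbol\mu_0)},$$ where $$T^*(\boldsymbol q_0,\boldsymbol\mu_0)=\sup_{w\in\Sigma_M}\ \inf_{\boldsymbol\lambda\in\mathrm{Alt}(\boldsymbol\mu_0)}\ \sum_{m=1}^M\sum_{k=1}^K w_m\,q^0_{m,k}\,\frac{(\mu^0_k-\lambda_k)^2}{2},$$ $\Sigma_M$ is the set of probability vectors $w=(w_1,\dots,w_M)$, and $\mathrm{Alt}(\boldsymbol\mu_0)$ is the set of $\boldsymbol\lambda\in\mathbb R^K$ that have a unique best arm, different from $a^\star(\boldsymbol\mu_0)$. All quantities take values in $[0,\infty]$, with $\inf\emptyset=\infty$, $1/0=\infty$ and $1/\infty=0$. 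-/

import Mathlib

open MeasureTheory ProbabilityTheory Filter Topology
open scoped ENNReal NNReal

namespace BoxedBandit

/-- `a` is the best arm, i.e. the unique arm with the largest mean. -/
def IsBest {K : ℕ} (μ : Fin K → ℝ) (a : Fin K) : Prop := ∀ k, k ≠ a → μ k < μ a

/-- Mean vectors that have a unique best arm which is not the best arm of `μ`. -/
def Alt {K : ℕ} (μ : Fin K → ℝ) : Set (Fin K → ℝ) := {l | ∃ b, IsBest l b ∧ ¬ IsBest μ b}

/-- A problem instance `(q, μ)` with `M` boxes and `K` unit-variance Gaussian arms, where `A m` is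
the set of arms accessible from box `m`. -/
structure Inst {M K : ℕ} (A : Fin M → Finset (Fin K)) where
  /-- `q m k` is the probability that arm `k` is pulled when box `m` is selected -/
  q : Fin M → Fin K → ℝ
  /-- `mean k` is the mean reward of arm `k` -/
  mean : Fin K → ℝ
  q_pos : ∀ m, ∀ k ∈ A m, 0 < q m k
  q_zero : ∀ m, ∀ k ∉ A m, q m k = 0
  q_sum : ∀ m, ∑ k, q m k = 1
  exists_best : ∃ a, IsBest mean a

/-- An observation: the selected box, the pulled arm, the reward. -/
abbrev Obs (M K : ℕ) : Type := Fin M × Fin K × ℝ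

/-- An action of the learner: select a box (`Sum.inl`), or stop and declare an arm (`Sum.inr`). -/
abbrev Action (M K : ℕ) : Type := Fin M ⊕ Fin K

/-- The outcome of a decision epoch: an observation, or the declared arm once stopped. -/
abbrev Outcome (M K : ℕ) : Type := Obs M K ⊕ Fin K

/-- A (possibly randomised) policy: after `t` observations, the history determines the law of the
next action. -/
structure Policy (M K : ℕ) where
  /-- the law of the action after a history of length `t` -/
  rule : (t : ℕ) → Kernel (Fin t → Obs M K) (Action M K)
  markov : ∀ t, IsMarkovKernel (rule t)

attribute [instance] Policy.markov

variable {M K : ℕ} {A : Fin M → Finset (Fin K)}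

/-- The law of (pulled arm, reward) when box `m` is selected: arm `k` with probability `q m k`,
then a reward with law `N(mean k, 1)`. -/
noncomputable def Inst.pull (C : Inst A) (m : Fin M) : Measure (Fin K × ℝ) :=
  ∑ k, ENNReal.ofReal (C.q m k) • (Measure.dirac k).prod (gaussianReal (C.mean k) 1)

theorem Inst.q_nonneg (C : Inst A) (m : Fin M) (k : Fin K) : 0 ≤ C.q m k := by
  by_cases h : k ∈ A m
  · exact (C.q_pos m k h).le
  · exact (C.q_zero m k h).ge

instance (C : Inst A) (m : Fin M) : IsProbabilityMeasure (C.pull m) := by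
  constructor
  simp [Inst.pull, Measure.finsetSum_apply, ← ENNReal.ofReal_sum_of_nonneg
    (fun k _ => C.q_nonneg m k), C.q_sum]

/-- The law of the outcome of an action. -/
noncomputable def Inst.respond (C : Inst A) : Kernel (Action M K) (Outcome M K) where
  toFun := Sum.elim (fun m => (C.pull m).map (fun y => Sum.inl (m, y)))
    (fun a => Measure.dirac (Sum.inr a))
  measurable' := measurable_fun_sum (measurable_of_countable _) (measurable_of_countable _)

instance (C : Inst A) : IsMarkovKernel C.respond := by
  constructor
  rintro (m | a)
  · exact Measure.isProbabilityMeasure_map (by fun_prop)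
  · exact Measure.dirac.isProbabilityMeasure

/-- The law of the next outcome after a history of `t` observations. -/
noncomputable def Inst.step (C : Inst A) (π : Policy M K) (t : ℕ) :
    Kernel (Fin t → Obs M K) (Outcome M K) :=
  C.respond ∘ₖ π.rule t

instance (C : Inst A) (π : Policy M K) (t : ℕ) : IsMarkovKernel (C.step π t) := by
  unfold Inst.step; infer_instance

/-- The observation in an outcome (with an immaterial value for a declaration). -/
def Outcome.obs [NeZero M] : Outcome M K → Obs M K := Sum.elim id (fun a => (0, a, 0))

theorem Outcome.measurable_obs [NeZero M] : Measurable (Outcome.obs : Outcome M K → Obs M K) :=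
  measurable_fun_sum measurable_id (measurable_of_countable _)

/-- The first `n + 1` outcomes, as a history of observations. -/
def history [NeZero M] (n : ℕ) (h : (_ : Finset.Iic n) → Outcome M K) : Fin (n + 1) → Obs M K :=
  fun j => (h ⟨j, Finset.mem_Iic.2 (Nat.lt_succ_iff.1 j.2)⟩).obs

theorem measurable_history [NeZero M] (n : ℕ) :
    Measurable (history n : ((_ : Finset.Iic n) → Outcome M K) → _) :=
  measurable_pi_lambda _ fun _ => Outcome.measurable_obs.comp (measurable_pi_apply _)

/-- The last of the first `n + 1` outcomes. -/
def last (n : ℕ) (h : (_ : Finset.Iic n) → Outcome M K) : Outcome M K :=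
  h ⟨n, Finset.mem_Iic.2 le_rfl⟩

theorem measurable_last (n : ℕ) :
    Measurable (last n : ((_ : Finset.Iic n) → Outcome M K) → _) :=
  measurable_pi_apply _

open Classical in
/-- The law of outcome `n + 1` given outcomes `0, …, n`: after stopping, the declaration is
repeated for ever; otherwise the policy acts on the history of the `n + 1` observations. -/
noncomputable def Inst.next [NeZero M] (C : Inst A) (π : Policy M K) (n : ℕ) :
    Kernel ((_ : Finset.Iic n) → Outcome M K) (Outcome M K) :=
  Kernel.piecewise (s := last n ⁻¹' Set.range Sum.inr)
    (measurable_last n measurableSet_range_inr)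
    (Kernel.deterministic (last n) (measurable_last n))
    ((C.step π (n + 1)).comap (history n) (measurable_history n))

instance [NeZero M] (C : Inst A) (π : Policy M K) (n : ℕ) : IsMarkovKernel (C.next π n) := by
  unfold Inst.next; infer_instance

/-- The law, under instance `C` and policy `π`, of the sequence of outcomes: `ω n` is
`Sum.inl (B, A, X)` with the box, arm and reward at time `n + 1` if the learner goes on after `n`
box selections, and `Sum.inr a` if it has stopped and declared `a`. -/
noncomputable def Inst.law [NeZero M] (C : Inst A) (π : Policy M K) :
    Measure (ℕ → Outcome M K) :=
  Kernel.trajMeasure (X := fun _ => Outcome M K) (C.step π 0 Fin.elim0) (C.next π)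

/-- The stopping time: the number of box selections before stopping (`⊤` if never stopped). -/
noncomputable def stopTime (ω : ℕ → Outcome M K) : ℕ∞ :=
  ⨅ (n : ℕ) (_ : ω n ∈ Set.range Sum.inr), (n : ℕ∞)

/-- The expected stopping time of `π` under instance `C`. -/
noncomputable def Inst.expStopTime [NeZero M] (C : Inst A) (π : Policy M K) : ℝ≥0∞ :=
  ∫⁻ ω, (stopTime ω : ℝ≥0∞) ∂(C.law π)

/-- The event that the learner stops and the declared arm is not the best arm of `C`. -/
def Inst.errorEvent (C : Inst A) : Set (ℕ → Outcome M K) :=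
  {ω | ∃ (n : ℕ) (a : Fin K), stopTime ω = n ∧ ω n = Sum.inr a ∧ ¬ IsBest C.mean a}

/-- The class `Π(δ)` of `δ`-probably correct policies. -/
def deltaPC [NeZero M] (A : Fin M → Finset (Fin K)) (δ : ℝ) : Set (Policy M K) :=
  {π | ∀ C : Inst A, C.law π C.errorEvent ≤ ENNReal.ofReal δ}

/-- The sup-inf value `T*(q, μ)`, in `[0, ∞]`. -/
noncomputable def Inst.Tstar (C : Inst A) : ℝ≥0∞ :=
  ⨆ w ∈ stdSimplex ℝ (Fin M), ⨅ l ∈ Alt C.mean,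
    ENNReal.ofReal (∑ m, ∑ k, w m * C.q m k * ((C.mean k - l k) ^ 2 / 2))

end BoxedBandit

namespace BoxedBandit

variable {M K : ℕ} {A : Fin M → Finset (Fin K)}

/-! Take a policy in `deltaPC A δ` with finite expected stopping time under `C`, and an instance `D`
with the same `q` whose best arm is not the best arm `a` of `C`. Declarations are repeated for ever,
so the event `E = {ω n = Sum.inr a}` has probability at most `δ` under `D`, while under `C` its
probability has liminf at least `1 - δ` as `n` grows.

The policy and the arm probabilities cancel in the likelihood ratio of the first `n + 1` outcomes,
which leaves a product of Gaussian ratios (`Inst.lintegral_law_change`). Let `S` be the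
log-likelihood ratio of `C` against `D`. Integrating `1 + x ≤ exp x` under `C` at `x = log (1 / δ) *
1_E - S` gives `log (1 / δ) * P(E) - 1 ≤ 𝔼 S` (`Inst.log_mul_le_sum_info`). By
`Inst.integral_llr_law`, `𝔼 S` is linear in the expected box counts.

Letting `n` tend to infinity (`Inst.le_sum_selections`) constrains one vector of counts against
every alternative at once. Dividing it by its sum, which is at most the expected stopping time,
gives a point of the simplex, hence `log (1 / δ) * (1 - δ) - 1 ≤ 𝔼 τ * T*`
(`Inst.ofReal_le_expStopTime_mul_Tstar`). -/

instance {α β : Type*} [MeasurableSpace α] [MeasurableSpace β] [MeasurableSingletonClass α]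
    [MeasurableSingletonClass β] : MeasurableSingletonClass (α ⊕ β) := by
  constructor
  rintro (a | b)
  · rw [← Set.image_singleton]
    exact measurableSet_inl_image.2 (MeasurableSet.singleton a)
  · rw [← Set.image_singleton]
    exact measurableSet_inr_image.2 (MeasurableSet.singleton b)

/-! ### One-step structure of the law of the outcomes -/

open Classical in
/-- The law of the action taken after `n + 1` outcomes: a past declaration is repeated. -/
noncomputable def Policy.act [NeZero M] (π : Policy M K) (n : ℕ) :
    Kernel ((_ : Finset.Iic n) → Outcome M K) (Action M K) :=
  Kernel.piecewise (s := last n ⁻¹' Set.range Sum.inr)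
    (measurable_last n measurableSet_range_inr)
    (Kernel.deterministic (fun h => Sum.map Prod.fst id (last n h))
      ((measurable_fun_sum (f := Sum.map Prod.fst id) (measurable_inl.comp measurable_fst)
          measurable_inr).comp
        (measurable_last n)))
    ((π.rule (n + 1)).comap (history n) (measurable_history n))

instance [NeZero M] (π : Policy M K) (n : ℕ) : IsMarkovKernel (π.act n) := by
  unfold Policy.act; infer_instance

theorem Inst.respond_inl (C : Inst A) (m : Fin M) :
    C.respond (Sum.inl m) = (C.pull m).map (fun y => Sum.inl (m, y)) := rfl

theorem Inst.respond_inr (C : Inst A) (a : Fin K) :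
    C.respond (Sum.inr a) = Measure.dirac (Sum.inr a) := rfl

-- Separates the learner from the environment: `π.act n` does not involve the instance. After a stop
-- the identity survives because the response to a declaration is a Dirac mass.
open Classical in
theorem Inst.next_eq [NeZero M] (C : Inst A) (π : Policy M K) (n : ℕ) :
    C.next π n = C.respond ∘ₖ π.act n := by
  ext1 h
  rw [Kernel.comp_apply, Inst.next, Policy.act, Kernel.piecewise_apply, Kernel.piecewise_apply]
  split_ifs with hs
  · obtain ⟨a, ha⟩ := hs
    rw [Kernel.deterministic_apply, Kernel.deterministic_apply,
      Measure.dirac_bind C.respond.measurable, ← ha]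
    rfl
  · rw [Kernel.comap_apply, Kernel.comap_apply, Inst.step, Kernel.comp_apply]

instance [NeZero M] (C : Inst A) (π : Policy M K) : IsProbabilityMeasure (C.law π) := by
  unfold Inst.law; infer_instance

/-- The first `n + 1` outcomes of a sequence. -/
def initial (n : ℕ) (ω : ℕ → Outcome M K) : (_ : Finset.Iic n) → Outcome M K := fun i => ω i

@[fun_prop]
theorem measurable_initial (n : ℕ) :
    Measurable (initial n : (ℕ → Outcome M K) → ((_ : Finset.Iic n) → Outcome M K)) :=
  measurable_pi_lambda _ fun _ => measurable_pi_apply _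

theorem Inst.law_compProd_next [NeZero M] (C : Inst A) (π : Policy M K) (n : ℕ) :
    (C.law π).map (initial n) ⊗ₘ C.next π n
      = (C.law π).map (fun ω => (initial n ω, ω (n + 1))) :=
  Kernel.map_frestrictLe_trajMeasure_compProd_eq_map_trajMeasure (X := fun _ => Outcome M K)

theorem Inst.law_map_zero [NeZero M] (C : Inst A) (π : Policy M K) :
    (C.law π).map (fun ω => ω 0) = C.respond ∘ₘ (π.rule 0 Fin.elim0) := by
  have h1 : (fun ω : ℕ → Outcome M K => ω 0)
      = (fun h : (_ : Finset.Iic 0) → Outcome M K => h ⟨0, by simp⟩) ∘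
        (Preorder.frestrictLe (π := fun _ => Outcome M K) 0) := rfl
  rw [h1, ← Measure.map_map (by fun_prop) (by fun_prop), Inst.law, Kernel.trajMeasure,
    Measure.map_comp _ _ (by fun_prop), Kernel.traj_map_frestrictLe, Kernel.partialTraj_self,
    Measure.id_comp, Measure.map_map (by fun_prop) (by fun_prop)]
  exact Measure.map_id

theorem Inst.law_map_succ [NeZero M] (C : Inst A) (π : Policy M K) (n : ℕ) :
    (C.law π).map (fun ω => ω (n + 1)) = C.respond ∘ₘ (π.act n ∘ₘ (C.law π).map (initial n)) := by
  rw [Measure.comp_assoc, ← C.next_eq, ← Measure.snd_compProd, C.law_compProd_next, Measure.snd,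
    Measure.map_map (by fun_prop) (by fun_prop)]
  rfl

/-- The mixing law may stay anonymous: its mass at each box is read off later through
`Inst.respond_box`. -/
theorem Inst.exists_law_map_eq [NeZero M] (C : Inst A) (π : Policy M K) (n : ℕ) :
    ∃ ν : Measure (Action M K), IsProbabilityMeasure ν ∧
      (C.law π).map (fun ω => ω n) = C.respond ∘ₘ ν := by
  rcases n with _ | n
  · exact ⟨_, inferInstance, C.law_map_zero π⟩
  · have : IsProbabilityMeasure ((C.law π).map (initial n)) :=
      Measure.isProbabilityMeasure_map (by fun_prop)
    exact ⟨_, inferInstance, C.law_map_succ π n⟩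

theorem Inst.lintegral_law_succ [NeZero M] (C : Inst A) (π : Policy M K) (n : ℕ)
    {f : ((_ : Finset.Iic n) → Outcome M K) → Outcome M K → ℝ≥0∞}
    (hf : Measurable (Function.uncurry f)) :
    ∫⁻ ω, f (initial n ω) (ω (n + 1)) ∂(C.law π)
      = ∫⁻ ω, ∫⁻ y, f (initial n ω) y ∂(C.next π n (initial n ω)) ∂(C.law π) := by
  have h := congrArg (fun μ => ∫⁻ p, Function.uncurry f p ∂μ) (C.law_compProd_next π n)
  beta_reduce at h
  rw [Measure.lintegral_compProd hf, lintegral_map hf (by fun_prop),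
    lintegral_map (f := fun a => ∫⁻ b, Function.uncurry f (a, b) ∂(C.next π n a))
      (by exact hf.lintegral_kernel_prod_right') (by fun_prop)] at h
  exact h.symm

/-! ### Change of measure -/

/-- The density `r` depends on the outcome alone, not on the action, so it survives averaging over
actions. -/
theorem Inst.lintegral_comp_respond {C D : Inst A}
    {r : Outcome M K → ℝ≥0∞}
    (hr : Measurable r) (hCD : ∀ a (f : Outcome M K → ℝ≥0∞), Measurable f →
      ∫⁻ y, f y ∂(D.respond a) = ∫⁻ y, f y * r y ∂(C.respond a))
    {μ : Measure (Action M K)} {f : Outcome M K → ℝ≥0∞} (hf : Measurable f) :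
    ∫⁻ y, f y ∂(D.respond ∘ₘ μ) = ∫⁻ y, f y * r y ∂(C.respond ∘ₘ μ) := by
  rw [Measure.lintegral_bind (Kernel.aemeasurable _) hf.aemeasurable,
    Measure.lintegral_bind (f := fun y => f y * r y) (Kernel.aemeasurable _)
      (hf.mul hr).aemeasurable]
  exact lintegral_congr fun a => hCD a f hf

/-- Change of measure: if the responses of `D` have density `r` with respect to those of `C`, then
the first `n + 1` outcomes under `D` have the product density with respect to `C`. -/
theorem Inst.lintegral_law_change [NeZero M] {C D : Inst A} {r : Outcome M K → ℝ≥0∞}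
    (hr : Measurable r) (hCD : ∀ a (f : Outcome M K → ℝ≥0∞), Measurable f →
      ∫⁻ y, f y ∂(D.respond a) = ∫⁻ y, f y * r y ∂(C.respond a))
    (π : Policy M K) (n : ℕ) {F : ((_ : Finset.Iic n) → Outcome M K) → ℝ≥0∞}
    (hF : Measurable F) :
    ∫⁻ ω, F (initial n ω) ∂(D.law π)
      = ∫⁻ ω, F (initial n ω) * ∏ t ∈ Finset.Iic n, r (ω t) ∂(C.law π) := by
  induction n with
  | zero =>
    have h0 : ∀ ω : ℕ → Outcome M K, initial 0 ω = (fun y _ => y) (ω 0) := by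
      intro ω
      funext i
      have : i.1 = 0 := Nat.le_zero.1 (Finset.mem_Iic.1 i.2)
      simp [initial, this]
    have hF' : Measurable fun y : Outcome M K => F (fun _ => y) :=
      hF.comp (by fun_prop)
    have h1 := lintegral_map (μ := D.law π) hF' (g := fun ω => ω 0) (by fun_prop)
    have h2 := lintegral_map (μ := C.law π) (hF'.mul hr) (g := fun ω => ω 0) (by fun_prop)
    simp only [h0]
    rw [← h1, D.law_map_zero, Inst.lintegral_comp_respond hr hCD hF', ← C.law_map_zero]
    refine h2.trans (lintegral_congr fun ω => ?_)
    have : Finset.Iic 0 = ({0} : Finset ℕ) := by ext; simp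
    simp [this]
  | succ n ih =>
    -- `e h y` appends the outcome `y` to the past `h`.
    let e : ((_ : Finset.Iic n) → Outcome M K) → Outcome M K →
        ((_ : Finset.Iic (n + 1)) → Outcome M K) :=
      fun h y i => if hi : i.1 ≤ n then h ⟨i.1, by simpa using hi⟩ else y
    have he : Measurable (Function.uncurry e) := by
      refine measurable_pi_lambda _ fun i => ?_
      by_cases hi : i.1 ≤ n
      · simp only [Function.uncurry_def, e, hi, dite_true]; fun_prop
      · simp only [Function.uncurry_def, e, hi, dite_false]; fun_prop
    have hi : ∀ ω : ℕ → Outcome M K, initial (n + 1) ω = e (initial n ω) (ω (n + 1)) := by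
      intro ω
      funext i
      by_cases hi : i.1 ≤ n
      · simp [e, hi, initial]
      · have hn : i.1 = n + 1 := by have := Finset.mem_Iic.1 i.2; omega
        simp only [e, hi, dite_false]
        exact congrArg ω hn
    have hG : Measurable (Function.uncurry fun h y => F (e h y)) := hF.comp he
    let R : ((_ : Finset.Iic n) → Outcome M K) → ℝ≥0∞ := fun h => ∏ i : Finset.Iic n, r (h i)
    have hR : Measurable R := by fun_prop
    have hRi : ∀ ω, R (initial n ω) = ∏ t ∈ Finset.Iic n, r (ω t) := fun ω =>
      Finset.prod_coe_sort (Finset.Iic n) (fun t => r (ω t))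
    have hH : Measurable (Function.uncurry fun h y => F (e h y) * r y * R h) :=
      (hG.mul (hr.comp measurable_snd)).mul (hR.comp measurable_fst)
    have hs : Finset.Iic (n + 1) = insert (n + 1) (Finset.Iic n) := by
      ext; simp; omega
    simp only [hi, hs, Finset.prod_insert (s := Finset.Iic n) (a := n + 1) (by simp)]
    -- Under `D` the last outcome is integrated out first; the induction hypothesis then applies to
    -- the resulting function of the past.
    rw [D.lintegral_law_succ π n hG,
      ih (F := fun h => ∫⁻ y, F (e h y) ∂(D.next π n h)) hG.lintegral_kernel_prod_right']
    have hR2 : ∀ ω : ℕ → Outcome M K,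
        F (e (initial n ω) (ω (n + 1))) * (r (ω (n + 1)) * ∏ t ∈ Finset.Iic n, r (ω t))
        = F (e (initial n ω) (ω (n + 1))) * r (ω (n + 1)) * R (initial n ω) := by
      intro ω; rw [hRi, mul_assoc]
    simp only [hR2]
    rw [C.lintegral_law_succ π n hH]
    refine lintegral_congr fun ω => ?_
    have hy : Measurable fun y => F (e (initial n ω) y) :=
      hG.comp (measurable_prodMk_left (x := initial n ω))
    rw [lintegral_mul_const (f := fun y => F (e (initial n ω) y) * r y) _ (hy.mul hr), hRi,
      D.next_eq, C.next_eq, Kernel.comp_apply, Kernel.comp_apply, Inst.lintegral_comp_respond hr hCD hy]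

/-! ### Declarations are absorbing -/

open Classical in
-- At a past ending in a declaration, `C.next` is the Dirac mass at that declaration.
theorem Inst.ae_absorbing [NeZero M] (C : Inst A) (π : Policy M K) :
    ∀ᵐ ω ∂(C.law π), ∀ n (a : Fin K), ω n = Sum.inr a → ω (n + 1) = Sum.inr a := by
  simp only [ae_all_iff]
  intro n a
  have hS : MeasurableSet ({Sum.inr a} : Set (Outcome M K)) :=
    MeasurableSet.singleton _
  have hm : MeasurableSet {p : ((_ : Finset.Iic n) → Outcome M K) × Outcome M K |
      last n p.1 = Sum.inr a → p.2 = Sum.inr a} := by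
    have h1 : MeasurableSet {p : ((_ : Finset.Iic n) → Outcome M K) × Outcome M K |
      last n p.1 = Sum.inr a} := ((measurable_last n).comp measurable_fst) hS
    have h2 : MeasurableSet {p : ((_ : Finset.Iic n) → Outcome M K) × Outcome M K |
      p.2 = Sum.inr a} := measurable_snd hS
    exact h1.imp h2
  have h : ∀ᵐ p ∂((C.law π).map (initial n) ⊗ₘ C.next π n),
      last n p.1 = Sum.inr a → p.2 = Sum.inr a := by
    rw [Measure.ae_compProd_iff hm]
    refine Eventually.of_forall fun h => ?_
    by_cases hl : last n h = Sum.inr a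
    · have hmem : h ∈ last n ⁻¹' Set.range (Sum.inr : Fin K → Outcome M K) := ⟨a, hl.symm⟩
      rw [Inst.next, Kernel.piecewise_apply, if_pos hmem, Kernel.deterministic_apply, hl]
      exact (ae_dirac_iff (measurable_prodMk_left (x := h) hm)).2 fun _ => rfl
    · simp [hl]
  rw [C.law_compProd_next, ae_map_iff (by fun_prop) hm] at h
  exact h

/-! ### Gaussian likelihood ratios and information per box -/

theorem lintegral_gaussianReal_change (a b : ℝ) {f : ℝ → ℝ≥0∞} (hf : Measurable f) :
    ∫⁻ x, f x ∂(gaussianReal b 1)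
      = ∫⁻ x, f x * ENNReal.ofReal (Real.exp (-(((x - b) ^ 2 - (x - a) ^ 2) / 2)))
        ∂(gaussianReal a 1) := by
  rw [gaussianReal_of_var_ne_zero b one_ne_zero, gaussianReal_of_var_ne_zero a one_ne_zero,
    lintegral_withDensity_eq_lintegral_mul _ (measurable_gaussianPDF b 1) hf,
    lintegral_withDensity_eq_lintegral_mul _ (measurable_gaussianPDF a 1) (by fun_prop)]
  refine lintegral_congr fun x => ?_
  simp only [Pi.mul_apply]
  rw [mul_left_comm, mul_comm (gaussianPDF b 1 x)]
  congr 1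
  rw [gaussianPDF, gaussianPDF, ← ENNReal.ofReal_mul (gaussianPDFReal_nonneg _ _ _),
    gaussianPDFReal, gaussianPDFReal, mul_assoc (√_)⁻¹, ← Real.exp_add]
  congr 3
  simp only [NNReal.coe_one]
  ring

theorem integrable_gaussianReal_llr (a b : ℝ) :
    Integrable (fun x => ((x - b) ^ 2 - (x - a) ^ 2) / 2) (gaussianReal a 1) := by
  have h : (fun x : ℝ => ((x - b) ^ 2 - (x - a) ^ 2) / 2)
      = fun x => (a - b) * x + (b ^ 2 - a ^ 2) / 2 := by funext x; ring
  have hi : Integrable (fun x : ℝ => x) (gaussianReal a 1) :=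
    (memLp_id_gaussianReal 1).integrable (by simp)
  rw [h]
  exact (hi.const_mul _).add (integrable_const _)

/-- The integrand is affine in `x`, so only the mean of the Gaussian enters; the value is the
Kullback–Leibler divergence. -/
theorem integral_gaussianReal_llr (a b : ℝ) :
    ∫ x, ((x - b) ^ 2 - (x - a) ^ 2) / 2 ∂(gaussianReal a 1) = (a - b) ^ 2 / 2 := by
  have h : (fun x : ℝ => ((x - b) ^ 2 - (x - a) ^ 2) / 2)
      = fun x => (a - b) * x + (b ^ 2 - a ^ 2) / 2 := by funext x; ring
  have hi : Integrable (fun x : ℝ => x) (gaussianReal a 1) :=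
    (memLp_id_gaussianReal 1).integrable (by simp)
  rw [h, integral_add (hi.const_mul _) (integrable_const _), integral_const_mul,
    integral_id_gaussianReal]
  simp
  ring

/-- The log-likelihood ratio of an outcome between the mean vectors `μ` and `l`. -/
noncomputable def llr (μ l : Fin K → ℝ) : Outcome M K → ℝ :=
  Sum.elim (fun o => ((o.2.2 - l o.2.1) ^ 2 - (o.2.2 - μ o.2.1) ^ 2) / 2) (fun _ => 0)

@[fun_prop]
theorem measurable_llr (μ l : Fin K → ℝ) : Measurable (llr μ l : Outcome M K → ℝ) := by
  have h (g : Fin K → ℝ) : Measurable fun o : Obs M K => g o.2.1 :=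
    (measurable_of_countable g).comp (measurable_fst.comp measurable_snd)
  have h1 := h l
  have h2 := h μ
  have h3 : Measurable fun o : Obs M K => ((o.2.2 - l o.2.1) ^ 2 - (o.2.2 - μ o.2.1) ^ 2) / 2 := by
    fun_prop
  exact measurable_fun_sum h3 measurable_const

/-- The information about `l` gained by one selection of box `m`. -/
noncomputable def Inst.info (C : Inst A) (l : Fin K → ℝ) (m : Fin M) : ℝ :=
  ∑ k, C.q m k * ((C.mean k - l k) ^ 2 / 2)

theorem Inst.info_nonneg (C : Inst A) (l : Fin K → ℝ) (m : Fin M) : 0 ≤ C.info l m :=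
  Finset.sum_nonneg fun k _ => mul_nonneg (C.q_nonneg m k) (by positivity)

theorem measurable_inl_mk (m : Fin M) (k : Fin K) :
    Measurable (fun x : ℝ => (Sum.inl (m, k, x) : Outcome M K)) :=
  measurable_inl.comp (by fun_prop)

theorem Inst.respond_inl_eq_sum (C : Inst A) (m : Fin M) :
    C.respond (Sum.inl m) = ∑ k, ENNReal.ofReal (C.q m k) •
      (gaussianReal (C.mean k) 1).map (fun x => (Sum.inl (m, k, x) : Outcome M K)) := by
  have hm : Measurable (fun y : Fin K × ℝ => (Sum.inl (m, y) : Outcome M K)) :=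
    measurable_inl.comp (by fun_prop)
  rw [C.respond_inl, Inst.pull, ← Measure.mapₗ_apply_of_measurable hm, map_sum]
  refine Finset.sum_congr rfl fun k _ => ?_
  rw [Measure.mapₗ_apply_of_measurable hm, Measure.map_smul, Measure.dirac_prod,
    Measure.map_map hm (by fun_prop)]
  rfl

/-- With equal `q` only the reward laws differ, and a declaration carries density one. -/
theorem Inst.lintegral_respond_change {C D : Inst A} (hq : D.q = C.q) (a : Action M K)
    (f : Outcome M K → ℝ≥0∞) (hf : Measurable f) :
    ∫⁻ y, f y ∂(D.respond a)
      = ∫⁻ y, f y * ENNReal.ofReal (Real.exp (-llr C.mean D.mean y)) ∂(C.respond a) := by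
  have hg : Measurable fun y => f y * ENNReal.ofReal (Real.exp (-llr C.mean D.mean y)) := by
    fun_prop
  rcases a with m | a
  · rw [D.respond_inl_eq_sum, C.respond_inl_eq_sum, lintegral_finsetSum_measure,
      lintegral_finsetSum_measure, hq]
    refine Finset.sum_congr rfl fun k _ => ?_
    rw [lintegral_smul_measure, lintegral_smul_measure, lintegral_map hf (measurable_inl_mk m k),
      lintegral_map hg (measurable_inl_mk m k),
      lintegral_gaussianReal_change (C.mean k) (f := fun x => f (Sum.inl (m, k, x))) _
        (hf.comp (measurable_inl_mk m k))]
    rfl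
  · rw [D.respond_inr, C.respond_inr, lintegral_dirac' _ hf, lintegral_dirac' _ hg]
    simp [llr]

theorem Inst.integrable_llr_respond (C : Inst A) (l : Fin K → ℝ) (a : Action M K) :
    Integrable (llr C.mean l) (C.respond a) := by
  rcases a with m | a
  · rw [C.respond_inl_eq_sum, integrable_finsetSum_measure]
    intro k _
    refine Integrable.smul_measure ?_ ENNReal.ofReal_ne_top
    rw [integrable_map_measure (measurable_llr _ _).aestronglyMeasurable
      (measurable_inl_mk m k).aemeasurable]
    exact integrable_gaussianReal_llr (C.mean k) (l k)
  · rw [C.respond_inr]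
    exact (integrable_dirac' (measurable_llr _ _).stronglyMeasurable (by simp))

theorem Inst.integral_llr_respond (C : Inst A) (l : Fin K → ℝ) (a : Action M K) :
    ∫ y, llr C.mean l y ∂(C.respond a) = Sum.elim (C.info l) (fun _ => 0) a := by
  have hi := C.integrable_llr_respond l a
  rcases a with m | a
  · rw [C.respond_inl_eq_sum, integrable_finsetSum_measure] at hi
    rw [C.respond_inl_eq_sum, integral_finsetSum_measure hi]
    refine Finset.sum_congr rfl fun k _ => ?_
    rw [integral_smul_measure, integral_map (measurable_inl_mk m k).aemeasurable
      (measurable_llr _ _).aestronglyMeasurable, ENNReal.toReal_ofReal (C.q_nonneg m k),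
      smul_eq_mul]
    congr 1
    exact integral_gaussianReal_llr (C.mean k) (l k)
  · rw [C.respond_inr, integral_dirac' _ _ (measurable_llr _ _).stronglyMeasurable]
    rfl

/-! ### Box selections and the expected log-likelihood ratio -/

/-- The outcomes in which box `m` is selected. -/
def box (m : Fin M) : Set (Outcome M K) := Sum.inl '' (Prod.fst ⁻¹' {m})

theorem measurableSet_box (m : Fin M) : MeasurableSet (box m : Set (Outcome M K)) :=
  measurableSet_inl_image.2 (measurable_fst (MeasurableSet.singleton m))

theorem Inst.respond_box (C : Inst A) (m : Fin M) (a : Action M K) :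
    C.respond a (box m) = ({Sum.inl m} : Set (Action M K)).indicator 1 a := by
  rcases a with m' | a
  · have hm : Measurable fun y : Fin K × ℝ => (Sum.inl (m', y) : Outcome M K) :=
      measurable_inl.comp (by fun_prop)
    rw [C.respond_inl, Measure.map_apply hm (measurableSet_box m)]
    by_cases h : m' = m
    · subst h
      have : (fun y : Fin K × ℝ => (Sum.inl (m', y) : Outcome M K)) ⁻¹' box m' = Set.univ := by
        ext y; simp [box]
      simp [this]
    · have : (fun y : Fin K × ℝ => (Sum.inl (m', y) : Outcome M K)) ⁻¹' box m = ∅ := by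
        ext y; simp [box, h]
      simp [this, h]
  · rw [C.respond_inr, Measure.dirac_apply' _ (measurableSet_box m)]
    simp [box]

/-- Each epoch contributes the information of the box it selects, and nothing once stopped. Working
epoch by epoch at a fixed horizon avoids optional stopping. -/
theorem Inst.integral_llr_law [NeZero M] (C : Inst A) (π : Policy M K) (l : Fin K → ℝ) (n : ℕ) :
    Integrable (fun ω => llr C.mean l (ω n)) (C.law π) ∧
    ∫ ω, llr C.mean l (ω n) ∂(C.law π)
      = ∑ m, (C.law π).real {ω | ω n ∈ box m} * C.info l m := by
  obtain ⟨ν, hν, h⟩ := C.exists_law_map_eq π n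
  have hn : Measurable fun ω : ℕ → Outcome M K => ω n := measurable_pi_apply n
  have hi : Integrable (llr C.mean l) (C.respond ∘ₘ ν) := by
    rw [Measure.integrable_comp_iff (measurable_llr _ _).aestronglyMeasurable]
    exact ⟨Eventually.of_forall fun a => C.integrable_llr_respond l a, Integrable.of_finite⟩
  have hb (m : Fin M) : (C.law π).real {ω | ω n ∈ box m} = ν.real {Sum.inl m} := by
    rw [measureReal_def, measureReal_def]
    congr 1
    change (C.law π) ((fun ω => ω n) ⁻¹' box m) = _
    rw [← Measure.map_apply hn (measurableSet_box m), h,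
      Measure.bind_apply (measurableSet_box m) (Kernel.aemeasurable _)]
    simp only [C.respond_box]
    rw [lintegral_indicator_one (MeasurableSet.singleton _)]
  constructor
  · rw [← h] at hi
    exact (integrable_map_measure (measurable_llr _ _).aestronglyMeasurable hn.aemeasurable).1 hi
  · have h1 := integral_map (μ := C.law π) hn.aemeasurable
      (measurable_llr C.mean l).aestronglyMeasurable
    rw [Measure.comp_eq_comp_const_apply] at hi
    rw [← h1, h, Measure.comp_eq_comp_const_apply, Kernel.integral_comp hi]
    simp only [Kernel.const_apply, C.integral_llr_respond, hb]
    rw [integral_fintype Integrable.of_finite]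
    simp

/-! ### The stopping time along a path -/

theorem stopTime_le {ω : ℕ → Outcome M K} {n : ℕ} {a : Fin K} (h : ω n = Sum.inr a) :
    stopTime ω ≤ n :=
  iInf₂_le_of_le n ⟨a, h.symm⟩ le_rfl

theorem exists_of_stopTime_eq {ω : ℕ → Outcome M K} {n : ℕ} (h : stopTime ω = n) :
    ∃ a, ω n = Sum.inr a := by
  classical
  have hex : ∃ n, ω n ∈ Set.range (Sum.inr : Fin K → Outcome M K) := by
    by_contra! hne
    have : stopTime ω = ⊤ := by simp [stopTime, hne]
    simp [this] at h
  have hle : ((Nat.find hex : ℕ) : ℕ∞) ≤ stopTime ω :=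
    le_iInf₂ fun k hk => by exact_mod_cast Nat.find_min' hex hk
  obtain ⟨a, ha⟩ := Nat.find_spec hex
  have hn : Nat.find hex = n := by
    have := h ▸ le_antisymm hle (stopTime_le ha.symm)
    exact_mod_cast this
  exact ⟨a, by rw [← hn, ha]⟩

theorem eq_inr_of_le {ω : ℕ → Outcome M K} (hω : ∀ n (a : Fin K), ω n = Sum.inr a →
    ω (n + 1) = Sum.inr a) {n k : ℕ} (hnk : n ≤ k) {a : Fin K} (h : ω n = Sum.inr a) :
    ω k = Sum.inr a := by
  induction k, hnk using Nat.le_induction with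
  | base => exact h
  | succ k _ ih => exact hω k a ih

/-- By absorption, an arm seen at any epoch is the one declared at the stopping time; this links
coordinate events to `Inst.errorEvent`. -/
theorem exists_stopTime_eq {ω : ℕ → Outcome M K} (hω : ∀ n (a : Fin K), ω n = Sum.inr a →
    ω (n + 1) = Sum.inr a) {n : ℕ} {a : Fin K} (h : ω n = Sum.inr a) :
    ∃ N : ℕ, stopTime ω = N ∧ ω N = Sum.inr a := by
  have hle := stopTime_le h
  obtain ⟨N, hN⟩ := ENat.ne_top_iff_exists.1 (ne_top_of_le_ne_top (ENat.natCast_ne_top n) hle)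
  obtain ⟨b, hb⟩ := exists_of_stopTime_eq hN.symm
  have hNn : N ≤ n := by rw [← hN] at hle; exact_mod_cast hle
  have := eq_inr_of_le hω hNn hb
  rw [h, Sum.inr.injEq] at this
  exact ⟨N, hN.symm, this ▸ hb⟩

/-! ### Expected box counts and error probabilities -/

/-- The expected number of selections of box `m`. -/
noncomputable def Inst.selections [NeZero M] (C : Inst A) (π : Policy M K) (m : Fin M) : ℝ≥0∞ :=
  ∑' n, C.law π {ω | ω n ∈ box m}

theorem sum_indicator_box (y : Outcome M K) :
    ∑ m, (box m).indicator (1 : Outcome M K → ℝ≥0∞) y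
      = (Set.range Sum.inl).indicator 1 y := by
  rcases y with ⟨m, o⟩ | a
  · rw [Finset.sum_eq_single m]
    · simp [box]
    · intro m' _ h
      simp [box, h.symm]
    · simp
  · simp [box]

theorem tsum_indicator_le_stopTime {ω : ℕ → Outcome M K} (hω : ∀ n (a : Fin K),
    ω n = Sum.inr a → ω (n + 1) = Sum.inr a) :
    ∑' n, (Set.range Sum.inl).indicator (1 : Outcome M K → ℝ≥0∞) (ω n) ≤ (stopTime ω : ℝ≥0∞) := by
  rcases eq_or_ne (stopTime ω) ⊤ with h | h
  · simp [h]
  obtain ⟨N, hN⟩ := ENat.ne_top_iff_exists.1 h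
  obtain ⟨a, ha⟩ := exists_of_stopTime_eq hN.symm
  rw [tsum_eq_sum (s := Finset.range N), ← hN]
  · refine (Finset.sum_le_sum fun n _ => Set.indicator_le_self' (by simp) (ω n)).trans ?_
    simp
  · intro n hn
    rw [eq_inr_of_le hω (by simpa using hn) ha]
    simp

theorem Inst.law_mem_box [NeZero M] (C : Inst A) (π : Policy M K) (n : ℕ) (m : Fin M) :
    C.law π {ω | ω n ∈ box m} = ∫⁻ ω, (box m).indicator 1 (ω n) ∂(C.law π) :=
  (lintegral_indicator_one (μ := C.law π) (s := (fun ω => ω n) ⁻¹' box m)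
    ((measurable_pi_apply n) (measurableSet_box m))).symm

theorem Inst.sum_selections_le [NeZero M] (C : Inst A) (π : Policy M K) :
    ∑ m, C.selections π m ≤ C.expStopTime π := by
  have hm (n : ℕ) (m : Fin M) : Measurable fun ω : ℕ → Outcome M K =>
      (box m).indicator (1 : Outcome M K → ℝ≥0∞) (ω n) :=
    (measurable_one.indicator (measurableSet_box m)).comp (measurable_pi_apply n)
  have h : ∑ m, C.selections π m
      = ∫⁻ ω, ∑' n, (Set.range Sum.inl).indicator (1 : Outcome M K → ℝ≥0∞) (ω n) ∂(C.law π) := by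
    simp only [← sum_indicator_box, Inst.selections, law_mem_box]
    rw [← Summable.tsum_finsetSum (fun _ _ => ENNReal.summable), lintegral_tsum fun n =>
      (Finset.measurable_sum _ fun m _ => hm n m).aemeasurable]
    exact tsum_congr fun n => (lintegral_finsetSum _ fun m _ => hm n m).symm
  rw [h]
  refine lintegral_mono_ae ?_
  filter_upwards [C.ae_absorbing π] with ω hω using tsum_indicator_le_stopTime hω

theorem Inst.law_eq_inr_le [NeZero M] {D : Inst A} {π : Policy M K} {δ : ℝ} (hπ : π ∈ deltaPC A δ)
    {a : Fin K} (ha : ¬ IsBest D.mean a) (n : ℕ) :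
    D.law π {ω | ω n = Sum.inr a} ≤ ENNReal.ofReal δ := by
  refine (measure_mono_ae ?_).trans (hπ D)
  filter_upwards [D.ae_absorbing π] with ω hω (h : ω n = Sum.inr a)
  obtain ⟨N, h1, h2⟩ := exists_stopTime_eq hω h
  exact ⟨N, a, h1, h2, ha⟩

theorem IsBest.eq {μ : Fin K → ℝ} {a b : Fin K} (ha : IsBest μ a) (hb : IsBest μ b) : a = b := by
  by_contra h
  exact lt_asymm (ha b (Ne.symm h)) (hb a h)

/-- Outcome `n` is the declaration of `a`, a wrong declaration, or a box selection. -/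
theorem Inst.one_le_law_eq_inr_add [NeZero M] {C : Inst A} {π : Policy M K} {δ : ℝ}
    (hπ : π ∈ deltaPC A δ) {a : Fin K} (ha : IsBest C.mean a) (n : ℕ) :
    1 ≤ C.law π {ω | ω n = Sum.inr a} + ENNReal.ofReal δ
      + ∑ m, C.law π {ω | ω n ∈ box m} := by
  have h : C.law π Set.univ ≤ C.law π (({ω | ω n = Sum.inr a} ∪ C.errorEvent)
      ∪ ⋃ m, {ω | ω n ∈ box m}) := by
    refine measure_mono_ae ?_
    filter_upwards [C.ae_absorbing π] with ω hω _
    rcases hn : ω n with ⟨m, o⟩ | b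
    · exact Or.inr (Set.mem_iUnion.2 ⟨m, by simp [hn, box]⟩)
    · left
      by_cases hb : b = a
      · exact Or.inl (by simp [hn, hb])
      · obtain ⟨N, h1, h2⟩ := exists_stopTime_eq hω hn
        exact Or.inr ⟨N, b, h1, h2, fun h => hb (h.eq ha)⟩
  rw [measure_univ] at h
  refine h.trans ((measure_union_le _ _).trans (add_le_add ((measure_union_le _ _).trans ?_) ?_))
  · exact add_le_add le_rfl (hπ C)
  · exact measure_iUnion_fintype_le _ _

/-! ### Transportation inequality -/

/-- Transportation inequality: the information collected in `n + 1` epochs is at least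
`log (1 / δ)` times the probability of an event that has probability at most `δ` under `D`. -/
theorem Inst.log_mul_le_sum_info [NeZero M] {C D : Inst A} (hq : D.q = C.q) (π : Policy M K)
    {δ : ℝ} (hδ : 0 < δ) (n : ℕ) {a : Fin K}
    (hD : D.law π {ω | ω n = Sum.inr a} ≤ ENNReal.ofReal δ) :
    Real.log (1 / δ) * (C.law π).real {ω | ω n = Sum.inr a} - 1
      ≤ ∑ t ∈ Finset.Iic n, ∑ m, (C.law π).real {ω | ω t ∈ box m} * C.info D.mean m := by
  set E : Set (ℕ → Outcome M K) := {ω | ω n = Sum.inr a}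
  have hE : MeasurableSet E := (measurable_pi_apply n) (MeasurableSet.singleton _)
  set c := Real.log (1 / δ)
  let S : (ℕ → Outcome M K) → ℝ := fun ω => ∑ t ∈ Finset.Iic n, llr C.mean D.mean (ω t)
  have hSi : Integrable S (C.law π) :=
    integrable_finsetSum _ fun t _ => (C.integral_llr_law π D.mean t).1
  have hS : ∫ ω, S ω ∂(C.law π)
      = ∑ t ∈ Finset.Iic n, ∑ m, (C.law π).real {ω | ω t ∈ box m} * C.info D.mean m := by
    rw [integral_finsetSum _ fun t _ => (C.integral_llr_law π D.mean t).1]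
    exact Finset.sum_congr rfl fun t _ => (C.integral_llr_law π D.mean t).2
  let φ : (ℕ → Outcome M K) → ℝ := E.indicator fun _ => c
  have hφ : Measurable φ := measurable_const.indicator hE
  have hφi : Integrable φ (C.law π) := (integrable_const c).indicator hE
  have hSm : Measurable S := by fun_prop
  let F : ((_ : Finset.Iic n) → Outcome M K) → ℝ≥0∞ := fun h =>
    ENNReal.ofReal (Real.exp (({Sum.inr a} : Set (Outcome M K)).indicator (fun _ => c) (last n h)))
  have hF : Measurable F :=
    (Real.measurable_exp.comp ((measurable_const.indicator (MeasurableSet.singleton _)).comp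
      (measurable_last n))).ennreal_ofReal
  have hFφ : ∀ ω, F (initial n ω) = ENNReal.ofReal (Real.exp (φ ω)) := fun ω => rfl
  have hchange := Inst.lintegral_law_change
    (r := fun y => ENNReal.ofReal (Real.exp (-llr C.mean D.mean y))) (by fun_prop)
    (Inst.lintegral_respond_change hq) π n hF
  have hlin : ∫⁻ ω, ENNReal.ofReal (Real.exp (φ ω - S ω)) ∂(C.law π) ≤ 2 := by
    have h1 : ∀ ω, ENNReal.ofReal (Real.exp (φ ω - S ω)) = F (initial n ω) *
        ∏ t ∈ Finset.Iic n, ENNReal.ofReal (Real.exp (-llr C.mean D.mean (ω t))) := by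
      intro ω
      rw [hFφ, ← ENNReal.ofReal_prod_of_nonneg (fun _ _ => (Real.exp_pos _).le), ← Real.exp_sum,
        ← ENNReal.ofReal_mul (Real.exp_pos _).le, ← Real.exp_add, Finset.sum_neg_distrib,
        sub_eq_add_neg]
    simp only [h1]
    rw [← hchange]
    -- `exp φ` is `1 / δ` on `E` and `1` elsewhere, so its mean under `D` is at most `(1 / δ) * δ +
    -- 1 = 2`.
    have h2 : ∀ ω, F (initial n ω) ≤ E.indicator (fun _ => ENNReal.ofReal (1 / δ)) ω + 1 := by
      intro ω
      rw [hFφ]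
      by_cases hω : ω ∈ E
      · simp only [φ, hω, Set.indicator_of_mem, c]
        rw [Real.exp_log (by positivity)]
        exact le_self_add
      · simp [φ, hω]
    refine (lintegral_mono h2).trans ?_
    rw [lintegral_add_right _ measurable_const, lintegral_indicator_const hE, lintegral_one,
      measure_univ, ← one_add_one_eq_two]
    gcongr
    calc ENNReal.ofReal (1 / δ) * D.law π E ≤ ENNReal.ofReal (1 / δ) * ENNReal.ofReal δ := by gcongr
      _ = 1 := by
        rw [← ENNReal.ofReal_mul (by positivity), one_div_mul_cancel hδ.ne', ENNReal.ofReal_one]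
  have hei : Integrable (fun ω => Real.exp (φ ω - S ω)) (C.law π) := by
    refine ⟨by fun_prop, ?_⟩
    rw [hasFiniteIntegral_iff_ofReal (Eventually.of_forall fun _ => (Real.exp_pos _).le)]
    exact hlin.trans_lt (by simp)
  have he : ∫ ω, Real.exp (φ ω - S ω) ∂(C.law π) ≤ 2 := by
    rw [integral_eq_lintegral_of_nonneg_ae (Eventually.of_forall fun _ => (Real.exp_pos _).le)
      hei.aestronglyMeasurable]
    exact ENNReal.toReal_le_of_le_ofReal (by norm_num) (by simpa using hlin)
  -- The inequality `1 + x ≤ exp x` at `x = φ - S`; the bound `2` on the exponential leaves the loss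
  -- `-1`.
  have hmono : ∫ ω, (1 + φ ω - Real.exp (φ ω - S ω)) ∂(C.law π) ≤ ∫ ω, S ω ∂(C.law π) := by
    refine integral_mono (((integrable_const 1).add hφi).sub hei) hSi fun ω => ?_
    have := Real.add_one_le_exp (φ ω - S ω)
    simp only
    linarith
  have hφint : ∫ ω, φ ω ∂(C.law π) = c * (C.law π).real E := by
    rw [integral_indicator_const _ hE, smul_eq_mul, mul_comm]
  rw [integral_sub (f := fun ω => 1 + φ ω) ((integrable_const 1).add hφi) hei,
    integral_add (integrable_const 1) hφi, hφint, hS] at hmono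
  simp only [integral_const, probReal_univ, smul_eq_mul, mul_one] at hmono
  linarith

/-! ### From box counts to the sup-inf value -/

theorem Inst.le_sum_selections [NeZero M] {C D : Inst A} (hq : D.q = C.q) {π : Policy M K}
    {δ : ℝ} (hδ : 0 < δ) (hδ1 : δ < 1) (hπ : π ∈ deltaPC A δ) {a : Fin K} (ha : IsBest C.mean a)
    (haD : ¬ IsBest D.mean a) (hτ : C.expStopTime π ≠ ⊤) :
    Real.log (1 / δ) * (1 - δ) - 1 ≤ ∑ m, (C.selections π m).toReal * C.info D.mean m := by
  have hc : 0 ≤ Real.log (1 / δ) := Real.log_nonneg (by rw [le_div_iff₀ hδ]; linarith)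
  have hfin (m : Fin M) : C.selections π m ≠ ⊤ :=
    ne_top_of_le_ne_top hτ ((Finset.single_le_sum (fun _ _ => zero_le) (Finset.mem_univ m)).trans
      (C.sum_selections_le π))
  -- The counts are finite sums of these probabilities, so the chance of still sampling at epoch `n`
  -- vanishes.
  have hp (m : Fin M) : Tendsto (fun n => (C.law π).real {ω | ω n ∈ box m}) atTop (𝓝 0) := by
    have := ENNReal.tendsto_atTop_zero_of_tsum_ne_top (hfin m)
    exact (ENNReal.tendsto_toReal ENNReal.zero_ne_top).comp this
  have hsum : ∀ n, ∑ t ∈ Finset.Iic n, ∑ m, (C.law π).real {ω | ω t ∈ box m} * C.info D.mean m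
      ≤ ∑ m, (C.selections π m).toReal * C.info D.mean m := by
    intro n
    rw [Finset.sum_comm]
    refine Finset.sum_le_sum fun m _ => ?_
    rw [← Finset.sum_mul]
    refine mul_le_mul_of_nonneg_right ?_ (C.info_nonneg _ m)
    simp only [measureReal_def]
    rw [← ENNReal.toReal_sum fun _ _ => measure_ne_top _ _]
    exact ENNReal.toReal_mono (hfin m) (ENNReal.sum_le_tsum _)
  have hbound : ∀ n, Real.log (1 / δ) * (1 - δ - ∑ m, (C.law π).real {ω | ω n ∈ box m}) - 1
      ≤ ∑ m, (C.selections π m).toReal * C.info D.mean m := by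
    intro n
    refine le_trans ?_ ((Inst.log_mul_le_sum_info hq π hδ n
      (Inst.law_eq_inr_le hπ haD n)).trans (hsum n))
    have h1 := ENNReal.toReal_mono (by simp [measure_ne_top])
      (Inst.one_le_law_eq_inr_add hπ ha n)
    rw [ENNReal.toReal_add (by simp) (by simp [measure_ne_top]),
      ENNReal.toReal_add (measure_ne_top _ _) ENNReal.ofReal_ne_top,
      ENNReal.toReal_sum fun _ _ => measure_ne_top _ _, ENNReal.toReal_ofReal hδ.le,
      ENNReal.toReal_one] at h1
    simp only [← measureReal_def] at h1
    gcongr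
    linarith
  have hlim : Tendsto (fun n => Real.log (1 / δ) *
      (1 - δ - ∑ m, (C.law π).real {ω | ω n ∈ box m}) - 1) atTop
      (𝓝 (Real.log (1 / δ) * (1 - δ) - 1)) := by
    have := tendsto_finsetSum Finset.univ fun m _ => hp m
    simpa using ((this.const_sub (1 - δ)).const_mul (Real.log (1 / δ))).sub_const 1
  exact le_of_tendsto' hlim hbound

theorem Inst.ofReal_le_expStopTime_mul_Tstar [NeZero M] {C : Inst A} {π : Policy M K}
    {δ : ℝ} (hδ : 0 < δ) (hδ1 : δ < 1) (hπ : π ∈ deltaPC A δ) (hA : (Alt C.mean).Nonempty)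
    (hτ : C.expStopTime π ≠ ⊤) :
    ENNReal.ofReal (Real.log (1 / δ) * (1 - δ) - 1) ≤ C.expStopTime π * C.Tstar := by
  set g := Real.log (1 / δ) * (1 - δ) - 1
  rcases le_or_gt g 0 with hg | hg
  · simp [ENNReal.ofReal_of_nonpos hg]
  obtain ⟨a, ha⟩ := C.exists_best
  have key : ∀ l ∈ Alt C.mean, g ≤ ∑ m, (C.selections π m).toReal * C.info l m := by
    rintro l ⟨b, hb, hbC⟩
    let D : Inst A := { C with mean := l, exists_best := ⟨b, hb⟩ }
    have haD : ¬ IsBest D.mean a := by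
      intro h
      obtain rfl : a = b := h.eq hb
      exact hbC ha
    exact Inst.le_sum_selections (C := C) (D := D) rfl hδ hδ1 hπ ha haD hτ
  set s : Fin M → ℝ := fun m => (C.selections π m).toReal
  have hs : ∀ m, 0 ≤ s m := fun m => ENNReal.toReal_nonneg
  have hfin (m : Fin M) : C.selections π m ≠ ⊤ :=
    ne_top_of_le_ne_top hτ ((Finset.single_le_sum (fun _ _ => zero_le) (Finset.mem_univ m)).trans
      (C.sum_selections_le π))
  have hSle : ENNReal.ofReal (∑ m, s m) ≤ C.expStopTime π := by
    rw [ENNReal.ofReal_sum_of_nonneg fun m _ => hs m]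
    simp only [s, ENNReal.ofReal_toReal (hfin _)]
    exact C.sum_selections_le π
  -- If every count vanished, `key` at any alternative would give `g ≤ 0`.
  have hS : 0 < ∑ m, s m := by
    refine (Finset.sum_nonneg fun m _ => hs m).lt_of_ne' fun h0 => ?_
    obtain ⟨l, hl⟩ := hA
    have hz := (Finset.sum_eq_zero_iff_of_nonneg fun m _ => hs m).1 h0
    have h := key l hl
    rw [Finset.sum_eq_zero fun m hm => by rw [show (C.selections π m).toReal = 0 from hz m hm,
      zero_mul]] at h
    linarith
  -- The normalised counts are the weights; they do not depend on `l`, so the bound passes through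
  -- the infimum.
  have hT : ENNReal.ofReal (g / ∑ m, s m) ≤ C.Tstar := by
    refine le_iSup₂_of_le (fun m => s m / ∑ m, s m)
      ⟨fun m => div_nonneg (hs m) hS.le, by rw [← Finset.sum_div, div_self hS.ne']⟩ ?_
    refine le_iInf₂ fun l hl => ENNReal.ofReal_le_ofReal ?_
    refine (div_le_div_of_nonneg_right (key l hl) hS.le).trans_eq ?_
    simp only [Inst.info, Finset.mul_sum, Finset.sum_div]
    exact Finset.sum_congr rfl fun m _ => Finset.sum_congr rfl fun k _ => by ring
  calc ENNReal.ofReal g = ENNReal.ofReal (∑ m, s m) * ENNReal.ofReal (g / ∑ m, s m) := by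
        rw [← ENNReal.ofReal_mul hS.le, mul_div_cancel₀ _ hS.ne']
    _ ≤ _ := mul_le_mul' hSle hT

/-! ### The limit of small error probability -/

theorem tendsto_log_ratio :
    Tendsto (fun δ : ℝ => (Real.log (1 / δ) * (1 - δ) - 1) / Real.log (1 / δ)) (𝓝[>] 0) (𝓝 1) := by
  have hl : Tendsto (fun δ : ℝ => Real.log (1 / δ)) (𝓝[>] 0) atTop := by
    simp only [one_div]
    exact Real.tendsto_log_atTop.comp tendsto_inv_nhdsGT_zero
  have h0 : Tendsto (fun δ : ℝ => δ) (𝓝[>] 0) (𝓝 0) := tendsto_id.mono_left nhdsWithin_le_nhds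
  have h := (h0.const_sub 1).sub hl.inv_tendsto_atTop
  rw [sub_zero, sub_zero] at h
  refine h.congr' ?_
  filter_upwards [hl.eventually_gt_atTop 0] with δ hδ
  simp only [Pi.inv_apply]
  field_simp

end BoxedBandit

open BoxedBandit in
theorem theorem1 {M K : ℕ} [NeZero M] (A : Fin M → Finset (Fin K)) (C₀ : BoxedBandit.Inst A) :
    1 / C₀.Tstar ≤
      liminf (fun δ : ℝ => ⨅ π ∈ BoxedBandit.deltaPC A δ,
        C₀.expStopTime π / ENNReal.ofReal (Real.log (1 / δ))) (𝓝[>] (0 : ℝ)) := by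
  -- Without alternatives (a single arm) the infimum over the empty set makes `Tstar` infinite and
  -- the bound zero.
  rcases (Alt C₀.mean).eq_empty_or_nonempty with hA | hA
  · have : C₀.Tstar = ⊤ := by
      refine top_le_iff.1 (le_iSup₂_of_le (Pi.single 0 1) (single_mem_stdSimplex ℝ 0) ?_)
      simp [hA]
    simp [this]
  have hlim : Tendsto (fun δ : ℝ => ENNReal.ofReal
      ((Real.log (1 / δ) * (1 - δ) - 1) / Real.log (1 / δ)) * (1 / C₀.Tstar)) (𝓝[>] 0)
      (𝓝 (1 / C₀.Tstar)) := by
    have := ENNReal.Tendsto.mul_const (b := 1 / C₀.Tstar)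
      (ENNReal.tendsto_ofReal tendsto_log_ratio) (Or.inl (by simp))
    simpa using this
  rw [← hlim.liminf_eq]
  refine liminf_le_liminf ?_
  filter_upwards [Ioo_mem_nhdsGT (zero_lt_one' ℝ)] with δ hδ
  have hlog : 0 < Real.log (1 / δ) := Real.log_pos (by rw [lt_div_iff₀ hδ.1]; linarith [hδ.2])
  refine le_iInf₂ fun π hπ => ?_
  rcases eq_or_ne (C₀.expStopTime π) ⊤ with hτ | hτ
  · simp [hτ, ENNReal.top_div_of_ne_top]
  calc _ = ENNReal.ofReal (Real.log (1 / δ) * (1 - δ) - 1) / C₀.Tstar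
        / ENNReal.ofReal (Real.log (1 / δ)) := by
        rw [ENNReal.ofReal_div_of_pos hlog, one_div C₀.Tstar, ENNReal.div_eq_inv_mul,
          ENNReal.div_eq_inv_mul, ENNReal.div_eq_inv_mul, mul_assoc, mul_comm C₀.Tstar⁻¹]
    _ ≤ _ := ENNReal.div_le_div_right (ENNReal.div_le_of_le_mul
        (Inst.ofReal_le_expStopTime_mul_Tstar hδ.1 hδ.2 hπ hA hτ)) _
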